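/- For every integer $t \ge 0$ and every $\varepsilon > 0$ there is a constant $C = C(t,\varepsilon) > 0$ such that the following holds for every finite field $\mathbb{F}_q$, every $d \ge 0$, every non-degenerate (not necessarily symmetric) bilinear form $B$ on $\mathbb{F}_q^d$ and every set $\mathcal{E} \subseteq \mathbb{F}_q \times \mathbb{F}_q^d$. For $\lambda = (\lambda_{ij})_{1 \le i < j \le t}$ with $\lambda_{ij} \in \mathbb{F}_q$, consider the system of $\binom{t}{2}$ equations \[ a_i + a_j + \lambda_{ij} = B(\mathbf{b}_i, \mathbf{b}_j), \qquad 1 \le i < j \le t, \] in the unknowns $(a_1, \mathbf{b}_1), \ldots, (a_t, \mathbf{b}_t) \in \mathcal{E}$ (not required to be distinct). (1) If $|\mathcal{E}| \ge C q^{\frac{d}{2} + t - 1}$, then for every $\lambda$ the number $N_\lambda$ of solutions of the system satisfies \[ \left| N_\lambda - \frac{|\mathcal{E}|^t}{q^{\binom{t}{2}}} \right| \le \varepsilon\, \frac{|\mathcal{E}|^t}{q^{\binom{t}{2}}}. \] (2) If $|\mathcal{E}| \ge C q^{\frac{d+t}{2}}$, then the system is solvable for at least $(1 - \varepsilon) q^{\binom{t}{2}}$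 of the $q^{\binom{t}{2}}$ choices of $\lambda$. In other words, $N_\lambda = (1 + o(1)) |\mathcal{E}|^t / q^{\binom{t}{2}}$ uniformly in $\lambda$ when $|\mathcal{E}| \gg q^{\frac{d}{2}+t-1}$, and the system is solvable for $(1 - o(1)) q^{\binom{t}{2}}$ choices of $\lambda$ when $|\mathcal{E}| \gg q^{\frac{d+t}{2}}$, where $X \gg Y$ means $Y = o(X)$. -/

import Mathlib

/-- The index set of the `t.choose 2` equations: pairs `i < j` of indices. -/
abbrev IndexPair (t : ℕ) : Type := {p : Fin t × Fin t // p.1 < p.2}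

/-- The solutions `((a₁, b₁), …, (a_t, b_t))`, with all `(a_i, b_i) ∈ E`, of the system
`a_i + a_j + lam_{ij} = B (b_i, b_j)`, `i < j`. -/
def sumProductSolutions {F : Type*} [Field F] {d t : ℕ}
    (B : LinearMap.BilinForm F (Fin d → F)) (E : Finset (F × (Fin d → F)))
    (lam : IndexPair t → F) : Set (Fin t → F × (Fin d → F)) :=
  {x | (∀ i, x i ∈ E) ∧
    ∀ p : IndexPair t,
      (x p.1.1).1 + (x p.1.2).1 + lam p = B (x p.1.1).2 (x p.1.2).2}

/-- The parameters `(lam_{ij})_{i < j}` for which the system has a solution in `E`. -/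
def solvableParameters {F : Type*} [Field F] {d : ℕ} (t : ℕ)
    (B : LinearMap.BilinForm F (Fin d → F)) (E : Finset (F × (Fin d → F))) :
    Set (IndexPair t → F) :=
  {lam | (sumProductSolutions B E lam).Nonempty}

/-! Write q = |F| and V = F^d. Each equation is a relation between two points of F × V, and its
indicator minus the density 1/q is a matrix `A`. Rows of `A` at points with different V-coordinates
are orthogonal, so `A * Aᵀ` is at most |V| times the identity, and `A` has norm at most q^(d/2)
(`hasKernelBound_sumProductKernel`).

A counting lemma for graphs on t vertices replaces edges by their density one at a time. Removing
the edge ij costs at most θ / |E| times the geometric mean of the counts with all edges at j, or all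
edges at i, deleted (`sum_mul_abs_weightedCount_sub_le`). A vertex meets at most t - 1 edges, so by
induction these counts exceed the main term by a factor of at most 2 q^(t-1). The relative error per
edge is then O(q^(d/2+t-1) / |E|), which gives (1).

For (2), pairs of tuples with equal parameters solve a system of the same kind over E × E, for the
form B ⊖ B on V × V. Its kernel depends on the two scalars only through their difference, and its
norm is at most q · q^d, so the counting lemma applies once |E|² ≫ q^(d+t). This bounds the
collisions, and Cauchy–Schwarz turns that into a lower bound for the number of parameters attained.
-/

open Finset

/-! ### Norm bound for the sum-product kernel -/

section AffineHyperplane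

variable {F V : Type*} [Field F] [Fintype F] [DecidableEq F] [AddCommGroup V] [Module F V]
  [Fintype V]

theorem card_fiber_mul_card_of_ne_zero (φ : V →ₗ[F] F) (hφ : φ ≠ 0) (c : F) :
    #{v | φ v = c} * Fintype.card F = Fintype.card V := by
  have hs : Function.Surjective φ := LinearMap.surjective hφ
  have key : ∀ c' : F, #{v | φ v = c'} = #{v | φ v = c} := by
    intro c'
    obtain ⟨w, hw⟩ := hs (c - c')
    refine Finset.card_bij (fun v _ => v + w) ?_ ?_ ?_
    · intro v hv
      simp only [mem_filter, mem_univ, true_and] at hv ⊢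
      rw [map_add, hv, hw]; ring
    · intro a _ b _ h
      exact add_right_cancel h
    · intro v hv
      simp only [mem_filter, mem_univ, true_and] at hv
      refine ⟨v - w, ?_, by simp⟩
      simp only [mem_filter, mem_univ, true_and]
      rw [map_sub, hv, hw]; ring
  have h := Finset.card_eq_sum_card_fiberwise (f := φ) (s := univ) (t := univ) (by simp)
  rw [Finset.sum_congr rfl (fun c' _ => key c')] at h
  simp only [sum_const, card_univ, smul_eq_mul] at h
  rw [h, mul_comm]

end AffineHyperplane

/-- The indicator of the sum-product relation `x.1 + y.1 + c = B x.2 y.2`. -/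
def sumProductKernel {F V : Type*} [Field F] [DecidableEq F] [AddCommGroup V] [Module F V]
    (B : LinearMap.BilinForm F V) (c : F) (x y : F × V) : ℝ :=
  if x.1 + y.1 + c = B x.2 y.2 then 1 else 0

/-- The bilinear form attached to `K` has norm at most `θ` for the Euclidean norms. -/
def HasKernelBound {X : Type*} [Fintype X] (K : X → X → ℝ) (θ : ℝ) : Prop :=
  ∀ g h : X → ℝ, |∑ x, ∑ y, g x * h y * K x y| ≤ θ * √(∑ x, g x ^ 2) * √(∑ x, h x ^ 2)

section Kernel

variable {F V : Type*} [Field F] [Fintype F] [DecidableEq F] [AddCommGroup V] [Module F V]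
  [Fintype V] [DecidableEq V]

/-- These are the entries of `A * Aᵀ`. For fixed b each relation determines a, and the two values
agree exactly when `B (x.2 - x'.2) b = x.1 - x'.1`. If the V-coordinates differ, this is an affine
hyperplane in b of density 1/q, and the entry cancels to zero. -/
theorem sum_sumProductKernel_mul (B : LinearMap.BilinForm F V)
    (hB : ∀ v, (∀ w, B v w = 0) → v = 0) (c : F) (x x' : F × V) :
    ∑ y, (sumProductKernel B c x y - 1 / (Fintype.card F : ℝ)) *
        (sumProductKernel B c x' y - 1 / (Fintype.card F : ℝ)) =
      (Fintype.card V : ℝ) * (if x = x' then 1 else 0) -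
        (Fintype.card V : ℝ) / Fintype.card F * (if x.2 = x'.2 then 1 else 0) := by
  set q : ℝ := (Fintype.card F : ℝ) with hq
  have hq0 : q ≠ 0 := by rw [hq]; exact_mod_cast Fintype.card_ne_zero
  have hin : ∀ b : V, ∑ a : F, (sumProductKernel B c x (a, b) - 1 / q) *
      (sumProductKernel B c x' (a, b) - 1 / q) =
      (if B (x.2 - x'.2) b = x.1 - x'.1 then 1 else 0) - 1 / q := by
    intro b
    have h1 : ∀ (z : F × V) (a : F), sumProductKernel B c z (a, b) =
        if a = B z.2 b - z.1 - c then 1 else 0 := by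
      intro z a
      unfold sumProductKernel
      congr 1
      apply propext
      constructor <;> intro h
      · rw [← h]; ring
      · simp only [h]; ring
    have h2 : ∀ a : F, (sumProductKernel B c x (a, b) - 1 / q) *
      (sumProductKernel B c x' (a, b) - 1 / q) =
        (if a = B x.2 b - x.1 - c then (if a = B x'.2 b - x'.1 - c then 1 else 0) else 0)
        - 1 / q * (if a = B x.2 b - x.1 - c then 1 else 0)
        - 1 / q * (if a = B x'.2 b - x'.1 - c then 1 else 0) + 1 / q * (1 / q) := by
      intro a
      rw [h1, h1]
      split_ifs <;> ring
    rw [Finset.sum_congr rfl fun a _ => h2 a]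
    simp only [sum_add_distrib, sum_sub_distrib, ← mul_sum, sum_ite_eq', mem_univ, if_true,
      sum_const, card_univ, nsmul_eq_mul, ← hq]
    have h3 : (B x.2 b - x.1 - c = B x'.2 b - x'.1 - c) ↔ B (x.2 - x'.2) b = x.1 - x'.1 := by
      rw [map_sub, LinearMap.sub_apply]
      constructor <;> intro h <;> linear_combination h
    simp only [h3]
    field_simp
    ring
  rw [Fintype.sum_prod_type_right, Finset.sum_congr rfl fun b _ => hin b, sum_sub_distrib,
    sum_const, card_univ, nsmul_eq_mul]
  by_cases h2 : x.2 = x'.2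
  · have h3 : (x = x') ↔ 0 = x.1 - x'.1 := by
      rw [Prod.ext_iff, eq_comm (a := (0 : F)), sub_eq_zero]; simp [h2]
    simp only [h2, sub_self, map_zero, LinearMap.zero_apply, h3, if_true]
    rw [sum_const, card_univ, nsmul_eq_mul]
    ring
  · have hne : x ≠ x' := fun h => h2 (by rw [h])
    have hφ : B (x.2 - x'.2) ≠ 0 := by
      intro h
      exact h2 (sub_eq_zero.1 (hB _ fun w => by rw [h]; rfl))
    have hc := card_fiber_mul_card_of_ne_zero (B (x.2 - x'.2)) hφ (x.1 - x'.1)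
    have hc' : (#{v | B (x.2 - x'.2) v = x.1 - x'.1} : ℝ) * q = Fintype.card V := by
      rw [hq]; exact_mod_cast hc
    rw [sum_boole, if_neg h2, if_neg hne, ← hc']
    field_simp
    ring

theorem HasKernelBound.of_sum_sq_le {X : Type*} [Fintype X] {K : X → X → ℝ} {θ : ℝ} (hθ : 0 ≤ θ)
    (h : ∀ g : X → ℝ, ∑ y, (∑ x, g x * K x y) ^ 2 ≤ θ ^ 2 * ∑ x, g x ^ 2) :
    HasKernelBound K θ := by
  intro g k
  have h1 : ∑ x, ∑ y, g x * k y * K x y = ∑ y, (∑ x, g x * K x y) * k y := by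
    rw [sum_comm]
    refine sum_congr rfl fun y _ => ?_
    rw [sum_mul]
    exact sum_congr rfl fun x _ => by ring
  have h2 := Finset.sum_mul_sq_le_sq_mul_sq univ (fun y => ∑ x, g x * K x y) k
  rw [h1]
  refine Real.abs_le_sqrt (h2.trans (mul_le_mul_of_nonneg_right (h g) (by positivity))) |>.trans ?_
  rw [Real.sqrt_mul (by positivity), Real.sqrt_mul (by positivity), Real.sqrt_sq hθ]

theorem hasKernelBound_sumProductKernel (B : LinearMap.BilinForm F V)
    (hB : ∀ v, (∀ w, B v w = 0) → v = 0) (c : F) :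
    HasKernelBound (fun x y => sumProductKernel B c x y - 1 / (Fintype.card F : ℝ))
      (√(Fintype.card V)) := by
  refine .of_sum_sq_le (Real.sqrt_nonneg _) fun g => ?_
  rw [Real.sq_sqrt (by positivity)]
  set q : ℝ := (Fintype.card F : ℝ) with hq
  set A : F × V → F × V → ℝ := fun x y => sumProductKernel B c x y - 1 / q with hA
  calc ∑ y, (∑ x, g x * A x y) ^ 2
      = ∑ x, ∑ x', g x * g x' * ∑ y, A x y * A x' y := by
        simp only [sq, sum_mul_sum]
        simp only [mul_sum]
        rw [sum_comm]
        refine sum_congr rfl fun x _ => ?_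
        rw [sum_comm]
        exact sum_congr rfl fun x' _ => sum_congr rfl fun y _ => by ring
    _ = ∑ x, ∑ x', g x * g x' * ((Fintype.card V : ℝ) * (if x = x' then 1 else 0) -
        (Fintype.card V : ℝ) / q * (if x.2 = x'.2 then 1 else 0)) := by
        simp only [hA, hq, sum_sumProductKernel_mul B hB c]
    -- The second term of the Gram matrix is a sum of squares over b, so it can be dropped.
    _ = (Fintype.card V : ℝ) * ∑ x, g x ^ 2 -
        (Fintype.card V : ℝ) / q * ∑ b : V, (∑ a : F, g (a, b)) ^ 2 := by
        simp only [mul_sub, sum_sub_distrib]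
        congr 1
        · rw [mul_sum]
          refine sum_congr rfl fun x _ => ?_
          simp only [mul_ite, mul_one, mul_zero, sum_ite_eq, mem_univ, if_true]
          ring
        · rw [Fintype.sum_prod_type_right, mul_sum]
          refine sum_congr rfl fun b _ => ?_
          simp only [Fintype.sum_prod_type, mul_ite, mul_one, mul_zero, sum_ite_eq, mem_univ,
            if_true]
          rw [sq, sum_mul_sum, mul_sum]
          refine sum_congr rfl fun a _ => ?_
          rw [mul_sum]
          exact sum_congr rfl fun a' _ => by ring
    _ ≤ (Fintype.card V : ℝ) * ∑ x, g x ^ 2 := by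
        have : 0 ≤ (Fintype.card V : ℝ) / q * ∑ b : V, (∑ a : F, g (a, b)) ^ 2 := by positivity
        linarith

/-- A kernel bound pulls back along a map whose fibres have at most `r` points. -/
theorem HasKernelBound.comap {X Y : Type*} [Fintype X] [Fintype Y] [DecidableEq Y]
    {K : Y → Y → ℝ} {θ : ℝ} (hθ : 0 ≤ θ) (hK : HasKernelBound K θ) (π : X → Y) (r : ℕ)
    (hr : ∀ y, #{x | π x = y} ≤ r) :
    HasKernelBound (fun x x' => K (π x) (π x')) (r * θ) := by
  intro g h
  set push : (X → ℝ) → Y → ℝ := fun g y => ∑ x with π x = y, g x with hpush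
  have hsum : ∑ x, ∑ x', g x * h x' * K (π x) (π x') =
      ∑ y, ∑ y', push g y * push h y' * K y y' := by
    rw [← sum_fiberwise univ π (fun x => ∑ x', g x * h x' * K (π x) (π x'))]
    refine sum_congr rfl fun y _ => ?_
    calc _ = ∑ x with π x = y, ∑ y', g x * push h y' * K y y' := ?_
      _ = _ := by
        rw [sum_comm]
        exact sum_congr rfl fun y' _ => by simp only [hpush, sum_mul]
    refine sum_congr rfl fun x hx => ?_
    rw [← sum_fiberwise univ π (fun x' => g x * h x' * K (π x) (π x'))]
    refine sum_congr rfl fun y' _ => ?_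
    rw [mul_sum, sum_mul]
    refine sum_congr rfl fun x' hx' => ?_
    rw [(mem_filter.1 hx).2, (mem_filter.1 hx').2]
  -- Cauchy–Schwarz on each fibre loses √r; the two arguments together lose r.
  have hnorm : ∀ g : X → ℝ, √(∑ y, push g y ^ 2) ≤ √r * √(∑ x, g x ^ 2) := by
    intro g
    rw [← Real.sqrt_mul (by positivity)]
    refine Real.sqrt_le_sqrt ?_
    rw [← sum_fiberwise univ π (fun x => g x ^ 2), mul_sum]
    refine sum_le_sum fun y _ => ?_
    refine sq_sum_le_card_mul_sum_sq.trans ?_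
    have := hr y
    gcongr
  rw [hsum]
  refine (hK _ _).trans ?_
  calc θ * √(∑ y, push g y ^ 2) * √(∑ y, push h y ^ 2)
      ≤ θ * (√r * √(∑ x, g x ^ 2)) * (√r * √(∑ x, h x ^ 2)) := by
        gcongr
        · exact hnorm g
        · exact hnorm h
    _ = (√r * √r) * θ * √(∑ x, g x ^ 2) * √(∑ x, h x ^ 2) := by ring
    _ = _ := by rw [Real.mul_self_sqrt (by positivity)]

end Kernel

/-! ### Decoupling two coordinates -/

section TwoCoordinates

variable {ι X : Type*} [Fintype ι] [DecidableEq ι] [Fintype X]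

/-- Exchanging the i-th coordinate with the extra point u is an involution. -/
theorem sum_sum_update (F : (ι → X) → ℝ) (i : ι) :
    ∑ x, ∑ u, F (Function.update x i u) = Fintype.card X * ∑ x, F x := by
  have h : ∑ z : (ι → X) × X, F (Function.update z.1 i z.2) = ∑ z : (ι → X) × X, F z.1 := by
    refine Fintype.sum_equiv
      ⟨fun z => (Function.update z.1 i z.2, z.1 i), fun z => (Function.update z.1 i z.2, z.1 i),
        fun z => by simp, fun z => by simp⟩ _ _ fun z => rfl
  rw [Fintype.sum_prod_type, Fintype.sum_prod_type] at h
  rw [h, mul_sum]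
  simp

theorem sum_sum_sum_update (F : (ι → X) → ℝ) (i j : ι) :
    ∑ x, ∑ u, ∑ v, F (Function.update (Function.update x i u) j v) =
      (Fintype.card X : ℝ) ^ 2 * ∑ x, F x := by
  rw [sum_sum_update (fun y => ∑ v, F (Function.update y j v)) i, sum_sum_update F j]
  ring

/-- If `R` depends on neither the `i`-th nor the `j`-th coordinate, `a` does not depend on the
`j`-th and `b` does not depend on the `i`-th, then a bounded kernel applied to the coordinates
`i` and `j` is controlled by two sums in which these coordinates are decoupled. -/
theorem HasKernelBound.sum_mul_abs_sum_le {A : X → X → ℝ} {θ : ℝ} (hθ : 0 ≤ θ)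
    (hA : HasKernelBound A θ) {i j : ι} (hij : i ≠ j) (f : X → ℝ) (hf : ∀ x, 0 ≤ f x)
    (R a b : (ι → X) → ℝ) (hR : ∀ x, 0 ≤ R x) (ha : ∀ x, 0 ≤ a x) (ha1 : ∀ x, a x ≤ 1)
    (hb : ∀ x, 0 ≤ b x) (hb1 : ∀ x, b x ≤ 1)
    (hRi : ∀ x u, R (Function.update x i u) = R x) (hRj : ∀ x u, R (Function.update x j u) = R x)
    (haj : ∀ x u, a (Function.update x j u) = a x)
    (hbi : ∀ x u, b (Function.update x i u) = b x) :
    (∑ x, f x) * |∑ x, R x * a x * b x * A (x i) (x j)| ≤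
      θ * (√(∑ x, R x * a x * f (x j)) * √(∑ x, R x * b x * f (x i))) := by
  set S := ∑ x, f x with hS
  have hS0 : 0 ≤ S := sum_nonneg fun x _ => hf x
  rcases isEmpty_or_nonempty X with hX | hX
  · have : S = 0 := by rw [hS]; simp
    rw [this, zero_mul]
    positivity
  set n : ℝ := (Fintype.card X : ℝ) with hn
  have hn0 : 0 < n := by rw [hn]; exact_mod_cast Fintype.card_pos
  -- Coordinates i and j are resampled as u and v, so that the kernel bound applies with the others
  -- frozen; this repeats every sum n² times.
  set α : (ι → X) → ℝ := fun x => ∑ u, a (Function.update x i u) with hα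
  set β : (ι → X) → ℝ := fun x => ∑ v, b (Function.update x j v) with hβ
  have hα0 : ∀ x, 0 ≤ α x := fun x => sum_nonneg fun _ _ => ha _
  have hβ0 : ∀ x, 0 ≤ β x := fun x => sum_nonneg fun _ _ => hb _
  have hb' : ∀ x u v, b (Function.update (Function.update x i u) j v) =
      b (Function.update x j v) := by
    intro x u v
    rw [Function.update_comm hij, hbi]
  have e1 : n ^ 2 * ∑ x, R x * a x * b x * A (x i) (x j) =
      ∑ x, R x * ∑ u, ∑ v, a (Function.update x i u) * b (Function.update x j v) * A u v := by
    rw [← sum_sum_sum_update (fun x => R x * a x * b x * A (x i) (x j)) i j]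
    refine sum_congr rfl fun x _ => ?_
    simp only [mul_sum]
    refine sum_congr rfl fun u _ => sum_congr rfl fun v _ => ?_
    rw [hRj, hRi, haj, hb']
    simp only [Function.update_self, Function.update_of_ne hij]
    ring
  -- Here the j-th coordinate occurs only in `f`, so summing over it produces the factor S.
  have e2 : n ^ 2 * ∑ x, R x * a x * f (x j) = S * ∑ x, R x * α x := by
    rw [← sum_sum_sum_update (fun x => R x * a x * f (x j)) i j, mul_sum]
    refine sum_congr rfl fun x _ => ?_
    simp only [hα, mul_sum]
    refine sum_congr rfl fun u _ => ?_
    rw [hS, sum_mul]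
    refine sum_congr rfl fun v _ => ?_
    rw [hRj, hRi, haj]
    simp only [Function.update_self]
    ring
  have e3 : n ^ 2 * ∑ x, R x * b x * f (x i) = S * ∑ x, R x * β x := by
    rw [← sum_sum_sum_update (fun x => R x * b x * f (x i)) i j, mul_sum]
    refine sum_congr rfl fun x _ => ?_
    rw [sum_comm]
    simp only [hβ, mul_sum]
    refine sum_congr rfl fun v _ => ?_
    rw [hS, sum_mul]
    refine sum_congr rfl fun u _ => ?_
    rw [hRj, hRi, hb']
    simp only [Function.update_self, Function.update_of_ne hij]
    ring
  have hpt : ∀ x, |∑ u, ∑ v, a (Function.update x i u) * b (Function.update x j v) * A u v| ≤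
      θ * (√(α x) * √(β x)) := by
    intro x
    refine (hA (fun u => a (Function.update x i u)) (fun v => b (Function.update x j v))).trans ?_
    rw [mul_assoc]
    refine mul_le_mul_of_nonneg_left (mul_le_mul ?_ ?_ (Real.sqrt_nonneg _) (Real.sqrt_nonneg _)) hθ
    -- Since 0 ≤ a ≤ 1, a² ≤ a turns the Euclidean norm into a count.
    · exact Real.sqrt_le_sqrt (sum_le_sum fun u _ => pow_le_of_le_one (ha _) (ha1 _) two_ne_zero)
    · exact Real.sqrt_le_sqrt (sum_le_sum fun u _ => pow_le_of_le_one (hb _) (hb1 _) two_ne_zero)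
  have hcs : |∑ x, R x * ∑ u, ∑ v, a (Function.update x i u) * b (Function.update x j v) * A u v| ≤
      θ * (√(∑ x, R x * α x) * √(∑ x, R x * β x)) := by
    calc _ ≤ ∑ x, θ * (√(R x * α x) * √(R x * β x)) := by
          refine (abs_sum_le_sum_abs _ _).trans (sum_le_sum fun x _ => ?_)
          rw [abs_mul, abs_of_nonneg (hR x), Real.sqrt_mul (hR x), Real.sqrt_mul (hR x)]
          calc _ ≤ R x * (θ * (√(α x) * √(β x))) := mul_le_mul_of_nonneg_left (hpt x) (hR x)
            _ = (√(R x) * √(R x)) * (θ * (√(α x) * √(β x))) := by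
                rw [Real.mul_self_sqrt (hR x)]
            _ = _ := by ring
      _ ≤ _ := by
          rw [← mul_sum]
          exact mul_le_mul_of_nonneg_left (Real.sum_sqrt_mul_sqrt_le _
            (fun x => mul_nonneg (hR x) (hα0 x)) (fun x => mul_nonneg (hR x) (hβ0 x))) hθ
  have hn2 : 0 < n ^ 2 := by positivity
  refine le_of_mul_le_mul_left ?_ hn2
  calc n ^ 2 * (S * |∑ x, R x * a x * b x * A (x i) (x j)|)
      = S * |n ^ 2 * ∑ x, R x * a x * b x * A (x i) (x j)| := by
        rw [abs_mul, abs_of_pos hn2]; ring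
    _ ≤ S * (θ * (√(∑ x, R x * α x) * √(∑ x, R x * β x))) := by
        rw [e1]; exact mul_le_mul_of_nonneg_left hcs hS0
    _ = θ * (√(S * ∑ x, R x * α x) * √(S * ∑ x, R x * β x)) := by
        rw [Real.sqrt_mul hS0, Real.sqrt_mul hS0]
        nth_rewrite 1 [← Real.mul_self_sqrt hS0]
        ring
    _ = n ^ 2 * (θ * (√(∑ x, R x * a x * f (x j)) * √(∑ x, R x * b x * f (x i)))) := by
        rw [← e2, ← e3, Real.sqrt_mul hn2.le, Real.sqrt_mul hn2.le, Real.sqrt_sq hn0.le]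
        ring

end TwoCoordinates

/-! ### The counting lemma -/

/-- The edge `p` contains the vertex `k`. -/
def IndexPair.Touches {t : ℕ} (k : Fin t) (p : IndexPair t) : Prop := p.1.1 = k ∨ p.1.2 = k

instance {t : ℕ} (k : Fin t) : DecidablePred (IndexPair.Touches k) := fun p =>
  inferInstanceAs (Decidable (p.1.1 = k ∨ p.1.2 = k))

theorem IndexPair.eq_of_touches {t : ℕ} {p p' : IndexPair t} (h₁ : p'.Touches p.1.1)
    (h₂ : p'.Touches p.1.2) : p' = p := by
  have := p.2
  have := p'.2
  apply Subtype.ext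
  apply Prod.ext <;> rcases h₁ with h₁ | h₁ <;> rcases h₂ with h₂ | h₂ <;> grind

theorem card_filter_touches_le {t : ℕ} (H : Finset (IndexPair t)) (k : Fin t) :
    #{p ∈ H | p.Touches k} ≤ t - 1 := by
  have h : #(univ.erase k) = t - 1 := by simp
  rw [← h]
  refine card_le_card_of_injOn (fun p => if p.1.1 = k then p.1.2 else p.1.1) ?_ ?_
  · intro p hp
    have hlt := p.2
    rw [mem_coe, mem_filter, IndexPair.Touches] at hp
    rw [mem_coe, mem_erase]
    grind
  · intro p hp p' hp' hpp
    have hlt := p.2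
    have hlt' := p'.2
    rw [mem_coe, mem_filter, IndexPair.Touches] at hp hp'
    simp only at hpp
    apply Subtype.ext
    apply Prod.ext <;> grind

/-- The number of `t`-tuples, each entry weighted by `f`, all of whose pairs in `H` are related,
the relation for the pair `p` being weighted by `K p`. -/
def weightedCount {X : Type*} [Fintype X] {t : ℕ} (f : X → ℝ) (K : IndexPair t → X → X → ℝ)
    (H : Finset (IndexPair t)) : ℝ :=
  ∑ x : Fin t → X, (∏ k, f (x k)) * ∏ p ∈ H, K p (x p.1.1) (x p.1.2)

theorem prod_kernel_update {X : Type*} {t : ℕ} {K : IndexPair t → X → X → ℝ}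
    (T : Finset (IndexPair t)) (k : Fin t)
    (hT : ∀ p ∈ T, ¬ p.Touches k) (x : Fin t → X) (u : X) :
    ∏ p ∈ T, K p (Function.update x k u p.1.1) (Function.update x k u p.1.2) =
      ∏ p ∈ T, K p (x p.1.1) (x p.1.2) := by
  refine prod_congr rfl fun p hp => ?_
  have := hT p hp
  unfold IndexPair.Touches at this
  push Not at this
  rw [Function.update_of_ne this.1, Function.update_of_ne this.2]

section WeightedCount

variable {X : Type*} [Fintype X] {t : ℕ} {f : X → ℝ} {K : IndexPair t → X → X → ℝ}

theorem weightedCount_empty : weightedCount f K ∅ = (∑ x, f x) ^ t := by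
  simp only [weightedCount, prod_empty, mul_one]
  rw [Fintype.sum_pow]

/-- Replacing the edge `p` by its density `c`. -/
theorem sum_mul_abs_weightedCount_sub_le {θ c : ℝ} (hθ : 0 ≤ θ) (hf : ∀ x, 0 ≤ f x)
    (hf1 : ∀ x, f x ≤ 1) (hK : ∀ p x y, 0 ≤ K p x y) (hK1 : ∀ p x y, K p x y ≤ 1)
    (hA : ∀ p, HasKernelBound (fun x y => K p x y - c) θ) {H : Finset (IndexPair t)}
    {p : IndexPair t} (hp : p ∈ H) :
    (∑ x, f x) * |weightedCount f K H - c * weightedCount f K (H.erase p)| ≤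
      θ * (√(weightedCount f K {e ∈ H | ¬ e.Touches p.1.2}) *
        √(weightedCount f K {e ∈ H | ¬ e.Touches p.1.1})) := by
  set i := p.1.1 with hi
  set j := p.1.2 with hj
  have hij : i ≠ j := p.2.ne
  set κ : (Fin t → X) → IndexPair t → ℝ := fun x e => K e (x e.1.1) (x e.1.2) with hκ
  set Ti := {e ∈ H | ¬ e.Touches i} with hTi
  set Tj := {e ∈ H | ¬ e.Touches j} with hTj
  -- Apart from `p`, no edge meets both i and j. The remaining factors therefore split into those
  -- free of both vertices (`R`), those at i (`a`) and those at j (`b`).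
  set R : (Fin t → X) → ℝ := fun x =>
    (∏ k ∈ (univ.erase i).erase j, f (x k)) * ∏ e ∈ Tj with ¬ e.Touches i, κ x e with hR
  set a : (Fin t → X) → ℝ := fun x => f (x i) * ∏ e ∈ Tj with e.Touches i, κ x e with ha
  set b : (Fin t → X) → ℝ := fun x => f (x j) * ∏ e ∈ Ti with e.Touches j, κ x e with hb
  have hcomm : {e ∈ Tj | ¬ e.Touches i} = {e ∈ Ti | ¬ e.Touches j} := by
    rw [hTi, hTj, filter_comm]
  have hf3 : ∀ x : Fin t → X, ∏ k, f (x k) =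
      f (x i) * (f (x j) * ∏ k ∈ (univ.erase i).erase j, f (x k)) := by
    intro x
    rw [mul_prod_erase _ (fun k => f (x k)) (mem_erase.2 ⟨hij.symm, mem_univ j⟩),
      mul_prod_erase _ (fun k => f (x k)) (mem_univ i)]
  have hprod : ∀ x, ∏ e ∈ H.erase p, κ x e = (∏ e ∈ Tj with e.Touches i, κ x e) *
      ((∏ e ∈ Ti with e.Touches j, κ x e) * ∏ e ∈ Tj with ¬ e.Touches i, κ x e) := by
    intro x
    rw [hcomm, prod_filter_mul_prod_filter_not,
      ← prod_filter_mul_prod_filter_not (H.erase p) (fun e => e.Touches i)]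
    congr 2
    · ext e
      simp only [hTj, mem_filter, mem_erase]
      constructor
      · rintro ⟨⟨h1, h2⟩, h3⟩
        exact ⟨⟨h2, fun h4 => h1 (IndexPair.eq_of_touches h3 h4)⟩, h3⟩
      · rintro ⟨⟨h1, h2⟩, h3⟩
        refine ⟨⟨?_, h1⟩, h3⟩
        rintro rfl
        exact h2 (Or.inr rfl)
    · ext e
      simp only [hTi, mem_filter, mem_erase]
      constructor
      · rintro ⟨⟨h1, h2⟩, h3⟩
        exact ⟨h2, h3⟩
      · rintro ⟨h1, h2⟩
        refine ⟨⟨?_, h1⟩, h2⟩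
        rintro rfl
        exact h2 (Or.inl rfl)
  have e1 : weightedCount f K H - c * weightedCount f K (H.erase p) =
      ∑ x, R x * a x * b x * (K p (x i) (x j) - c) := by
    unfold weightedCount
    rw [mul_sum, ← sum_sub_distrib]
    refine sum_congr rfl fun x _ => ?_
    have h1 : ∏ e ∈ H, κ x e = κ x p * ∏ e ∈ H.erase p, κ x e := (mul_prod_erase _ _ hp).symm
    change (∏ k, f (x k)) * ∏ e ∈ H, κ x e - c * ((∏ k, f (x k)) * ∏ e ∈ H.erase p, κ x e) = _
    rw [h1, hprod, hf3]
    simp only [hR, ha, hb, hκ]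
    ring
  have e2 : weightedCount f K Tj = ∑ x, R x * a x * f (x j) := by
    refine sum_congr rfl fun x _ => ?_
    change (∏ k, f (x k)) * ∏ e ∈ Tj, κ x e = _
    rw [hf3, ← prod_filter_mul_prod_filter_not Tj (fun e => e.Touches i)]
    simp only [hR, ha]
    ring
  have e3 : weightedCount f K Ti = ∑ x, R x * b x * f (x i) := by
    refine sum_congr rfl fun x _ => ?_
    change (∏ k, f (x k)) * ∏ e ∈ Ti, κ x e = _
    rw [hf3, ← prod_filter_mul_prod_filter_not Ti (fun e => e.Touches j)]
    simp only [hR, hb, hcomm]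
    ring
  have hfu : ∀ k : Fin t, k = i ∨ k = j → ∀ x u,
      ∏ l ∈ (univ.erase i).erase j, f (Function.update x k u l) =
        ∏ l ∈ (univ.erase i).erase j, f (x l) := by
    intro k hk x u
    refine prod_congr rfl fun l hl => ?_
    rw [Function.update_of_ne]
    rintro rfl
    simp only [mem_erase, mem_univ, and_true] at hl
    tauto
  rw [e1, e2, e3]
  refine (hA p).sum_mul_abs_sum_le hθ hij f hf R a b ?_ ?_ ?_ ?_ ?_ ?_ ?_ ?_ ?_
  · exact fun x => mul_nonneg (prod_nonneg fun _ _ => hf _) (prod_nonneg fun _ _ => hK _ _ _)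
  · exact fun x => mul_nonneg (hf _) (prod_nonneg fun _ _ => hK _ _ _)
  · exact fun x => mul_le_one₀ (hf1 _) (prod_nonneg fun _ _ => hK _ _ _)
      (prod_le_one (fun _ _ => hK _ _ _) fun _ _ => hK1 _ _ _)
  · exact fun x => mul_nonneg (hf _) (prod_nonneg fun _ _ => hK _ _ _)
  · exact fun x => mul_le_one₀ (hf1 _) (prod_nonneg fun _ _ => hK _ _ _)
      (prod_le_one (fun _ _ => hK _ _ _) fun _ _ => hK1 _ _ _)
  · intro x u
    simp only [hR, hκ]
    rw [hfu i (Or.inl rfl), prod_kernel_update _ i (by simp)]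
  · intro x u
    simp only [hR, hκ]
    rw [hfu j (Or.inr rfl), hcomm, prod_kernel_update _ j (by simp)]
  · intro x u
    simp only [ha, hκ]
    rw [Function.update_of_ne hij, prod_kernel_update _ j (by simp [hTj]; tauto)]
  · intro x u
    simp only [hb, hκ]
    rw [Function.update_of_ne hij.symm, prod_kernel_update _ i (by simp [hTi]; tauto)]

/-- Counting lemma: with `η = θ q ^ (t - 1) / ∑ f`, every edge contributes a relative error of
at most `2 η`. -/
theorem abs_weightedCount_sub_le {θ q η : ℝ} (hθ : 0 ≤ θ) (hq : 1 ≤ q) (hf : ∀ x, 0 ≤ f x)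
    (hf1 : ∀ x, f x ≤ 1) (hS : 0 < ∑ x, f x) (hK : ∀ p x y, 0 ≤ K p x y)
    (hK1 : ∀ p x y, K p x y ≤ 1) (hA : ∀ p, HasKernelBound (fun x y => K p x y - 1 / q) θ)
    (hη : θ * q ^ (t - 1) ≤ η * ∑ x, f x) (H : Finset (IndexPair t)) (hH : 2 * #H * η ≤ 1) :
    |weightedCount f K H - (∑ x, f x) ^ t / q ^ #H| ≤
      2 * #H * η * ((∑ x, f x) ^ t / q ^ #H) := by
  set S := ∑ x, f x with hSdef
  have hq0 : 0 < q := one_pos.trans_le hq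
  have hη0 : 0 ≤ η := by
    refine nonneg_of_mul_nonneg_left ?_ hS
    exact le_trans (by positivity) hη
  induction hn : #H using Nat.strong_induction_on generalizing H with
  | _ m ih =>
  rcases H.eq_empty_or_nonempty with rfl | ⟨p, hp⟩
  · simp only [card_empty] at hn
    subst hn
    rw [weightedCount_empty]
    simp [hSdef]
  have hm : 0 < m := by rw [← hn]; exact card_pos.2 ⟨p, hp⟩
  rw [hn] at hH
  have hsmall : ∀ T : Finset (IndexPair t), #T < m → 2 * (#T : ℝ) * η ≤ 1 := by
    intro T hT
    refine le_trans ?_ hH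
    gcongr
  set P := S ^ t / q ^ m with hP
  have hP0 : 0 < P := by positivity
  -- By induction and 2 #T η ≤ 1, the count is at most twice its main term; the at most t - 1
  -- deleted edges account for q^(t-1).
  have hdel : ∀ k, p.Touches k → weightedCount f K {e ∈ H | ¬ e.Touches k} ≤
      2 * (P * q ^ (t - 1)) := by
    intro k hk
    set T := {e ∈ H | ¬ e.Touches k} with hT
    have hTm : #T < m := by
      rw [← hn]
      refine card_lt_card (filter_ssubset.2 ⟨p, hp, not_not.2 hk⟩)
    have h1 := ih #T hTm T (hsmall T hTm) rfl
    have h2 : 2 * (#T : ℝ) * η * (S ^ t / q ^ #T) ≤ 1 * (S ^ t / q ^ #T) := by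
      have := hsmall T hTm
      gcongr
    have h3 : weightedCount f K T ≤ 2 * (S ^ t / q ^ #T) := by
      have := (abs_le.1 h1).2
      linarith
    refine h3.trans (mul_le_mul_of_nonneg_left ?_ two_pos.le)
    rw [hP, div_mul_eq_mul_div, div_le_div_iff₀ (by positivity) (by positivity), mul_assoc,
      ← pow_add]
    have hcard : m ≤ t - 1 + #T := by
      have := card_filter_touches_le H k
      have h4 := card_filter_add_card_filter_not (s := H) (fun e => e.Touches k)
      rw [hn] at h4
      change _ + #T = m at h4
      omega
    have := pow_le_pow_right₀ hq hcard
    gcongr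
  have hstep : |weightedCount f K H - 1 / q * weightedCount f K (H.erase p)| ≤ 2 * η * P := by
    refine le_of_mul_le_mul_left ?_ hS
    calc _ ≤ θ * (√(2 * (P * q ^ (t - 1))) * √(2 * (P * q ^ (t - 1)))) := by
          refine (sum_mul_abs_weightedCount_sub_le hθ hf hf1 hK hK1 hA hp).trans ?_
          have h1 := hdel p.1.2 (Or.inr rfl)
          have h2 := hdel p.1.1 (Or.inl rfl)
          gcongr
      _ = 2 * P * (θ * q ^ (t - 1)) := by
          rw [Real.mul_self_sqrt (by positivity)]; ring
      _ ≤ 2 * P * (η * S) := by gcongr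
      _ = _ := by ring
  have hcard : #(H.erase p) = m - 1 := by rw [card_erase_of_mem hp, hn]
  have hlt : #(H.erase p) < m := by omega
  have hind := ih _ hlt (H.erase p) (hsmall _ hlt) rfl
  have hPq : S ^ t / q ^ #(H.erase p) = q * P := by
    rw [hP, hcard]
    obtain ⟨n, rfl⟩ : ∃ n, m = n + 1 := ⟨m - 1, by omega⟩
    rw [Nat.add_sub_cancel, pow_succ]
    field_simp
  have hcast : ((#(H.erase p) : ℕ) : ℝ) = m - 1 := by
    rw [hcard, Nat.cast_sub hm, Nat.cast_one]
  rw [hPq, hcast] at hind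
  have hind' : |1 / q * weightedCount f K (H.erase p) - P| ≤ 2 * (m - 1) * η * P := by
    have : 1 / q * weightedCount f K (H.erase p) - P =
        1 / q * (weightedCount f K (H.erase p) - q * P) := by field_simp
    rw [this, abs_mul, abs_of_pos (by positivity)]
    calc _ ≤ 1 / q * (2 * ((m : ℝ) - 1) * η * (q * P)) := by gcongr
      _ = _ := by field_simp
  calc |weightedCount f K H - P| ≤ |weightedCount f K H - 1 / q * weightedCount f K (H.erase p)| +
        |1 / q * weightedCount f K (H.erase p) - P| := abs_sub_le _ _ _
    _ ≤ 2 * η * P + 2 * (m - 1) * η * P := add_le_add hstep hind'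
    _ = _ := by ring

end WeightedCount

/-! ### Complete systems and collisions -/

theorem card_indexPair (t : ℕ) : Fintype.card (IndexPair t) = t.choose 2 := by
  have h : ∀ j : Fin t, (∑ i : Fin t, if i < j then 1 else 0) = (j : ℕ) := by
    intro j
    rw [← card_filter, filter_gt_eq_Iio, Fin.card_Iio]
  rw [Fintype.card_subtype, card_filter, Fintype.sum_prod_type_right, sum_congr rfl fun j _ => h j,
    Fin.sum_univ_eq_sum_range (fun j => j), sum_range_id, Nat.choose_two_right]

/-- Cauchy–Schwarz for the fibre sizes, whose squares add up to the number of collisions. -/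
theorem card_sq_le_card_image_mul_card_collisions {α β : Type*} [DecidableEq β]
    (s : Finset α) (Φ : α → β) :
    #s ^ 2 ≤ #(s.image Φ) * #{z ∈ s ×ˢ s | Φ z.1 = Φ z.2} := by
  have h1 : #s = ∑ c ∈ s.image Φ, #{x ∈ s | Φ x = c} :=
    card_eq_sum_card_fiberwise fun _ => mem_image_of_mem _
  have h2 : #{z ∈ s ×ˢ s | Φ z.1 = Φ z.2} = ∑ c ∈ s.image Φ, #{x ∈ s | Φ x = c} ^ 2 := by
    rw [card_eq_sum_card_fiberwise (f := fun z : α × α => Φ z.1) (t := s.image Φ)]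
    · refine sum_congr rfl fun c _ => ?_
      rw [sq, ← card_product]
      congr 1
      ext z
      simp only [mem_filter, mem_product]
      grind
    · intro z hz
      simp only [coe_filter, mem_product] at hz
      exact mem_coe.2 (mem_image_of_mem _ hz.1.1)
  rw [h2, h1]
  exact sq_sum_le_card_mul_sum_sq

theorem weightedCount_ite {X : Type*} [Fintype X] {t : ℕ} (P : X → Prop) [DecidablePred P]
    (r : IndexPair t → X → X → Prop) [∀ p x y, Decidable (r p x y)] :
    weightedCount (fun x => if P x then 1 else 0) (fun p x y => if r p x y then 1 else 0) univ =
      #{x : Fin t → X | (∀ k, P (x k)) ∧ ∀ p : IndexPair t, r p (x p.1.1) (x p.1.2)} := by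
  unfold weightedCount
  simp only [prod_boole, mem_univ, true_imp_iff]
  rw [← sum_boole]
  refine sum_congr rfl fun x _ => ?_
  split_ifs <;> simp_all

theorem abs_weightedCount_univ_sub_le {X : Type*} [Fintype X] {t : ℕ} {f : X → ℝ}
    {K : IndexPair t → X → X → ℝ} {θ q δ : ℝ} (hθ : 0 ≤ θ) (hq : 1 ≤ q) (hf : ∀ x, 0 ≤ f x)
    (hf1 : ∀ x, f x ≤ 1) (hS : 0 < ∑ x, f x) (hK : ∀ p x y, 0 ≤ K p x y)
    (hK1 : ∀ p x y, K p x y ≤ 1) (hA : ∀ p, HasKernelBound (fun x y => K p x y - 1 / q) θ)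
    (hδ : δ ≤ 1) (h : 2 * (t.choose 2 : ℝ) * (θ * q ^ (t - 1)) ≤ δ * ∑ x, f x) :
    |weightedCount f K univ - (∑ x, f x) ^ t / q ^ t.choose 2| ≤
      δ * ((∑ x, f x) ^ t / q ^ t.choose 2) := by
  set S := ∑ x, f x with hSdef
  have hcard : #(univ : Finset (IndexPair t)) = t.choose 2 := by
    rw [card_univ, card_indexPair]
  have hle : 2 * (#(univ : Finset (IndexPair t)) : ℝ) * (θ * q ^ (t - 1) / S) ≤ δ := by
    rw [hcard, mul_div_assoc', div_le_iff₀ hS]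
    exact h
  have := abs_weightedCount_sub_le (η := θ * q ^ (t - 1) / S) hθ hq hf hf1 hS hK hK1 hA
    (by rw [div_mul_cancel₀ _ hS.ne']) univ (hle.trans hδ)
  rw [← hSdef, hcard] at this
  rw [hcard] at hle
  refine this.trans (mul_le_mul_of_nonneg_right hle ?_)
  positivity

section DifferenceForm

variable {F V : Type*} [Field F] [AddCommGroup V] [Module F V]

/-- The form `B (v.1, w.1) - B (v.2, w.2)` on `V × V`. -/
def differenceForm (B : LinearMap.BilinForm F V) : LinearMap.BilinForm F (V × V) :=
  B.compl₁₂ (LinearMap.fst F V V) (LinearMap.fst F V V) -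
    B.compl₁₂ (LinearMap.snd F V V) (LinearMap.snd F V V)

theorem differenceForm_apply (B : LinearMap.BilinForm F V) (v w : V × V) :
    differenceForm B v w = B v.1 w.1 - B v.2 w.2 := rfl

theorem differenceForm_separatingLeft {B : LinearMap.BilinForm F V}
    (hB : ∀ v, (∀ w, B v w = 0) → v = 0) (v : V × V)
    (h : ∀ w, differenceForm B v w = 0) : v = 0 := by
  refine Prod.ext (hB _ fun w => ?_) (hB _ fun w => ?_)
  · simpa [differenceForm_apply] using h (w, 0)
  · simpa [differenceForm_apply] using h (0, w)

end DifferenceForm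

/-! ### Application to the sum-product system -/

section Counting

variable {F V : Type*} [Field F] [Fintype F] [DecidableEq F] [AddCommGroup V] [Module F V]
  [Fintype V] [DecidableEq V] {t : ℕ}

theorem abs_card_solutions_sub_le (B : LinearMap.BilinForm F V)
    (hB : ∀ v, (∀ w, B v w = 0) → v = 0) (E : Finset (F × V)) (hE : E.Nonempty) {δ : ℝ}
    (hδ : δ ≤ 1)
    (h : 2 * (t.choose 2 : ℝ) * (√(Fintype.card V) * (Fintype.card F : ℝ) ^ (t - 1)) ≤ δ * #E)
    (lam : IndexPair t → F) :
    |(#{x : Fin t → F × V | (∀ k, x k ∈ E) ∧ ∀ p : IndexPair t,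
        (x p.1.1).1 + (x p.1.2).1 + lam p = B (x p.1.1).2 (x p.1.2).2} : ℝ) -
        (#E : ℝ) ^ t / (Fintype.card F : ℝ) ^ t.choose 2| ≤
      δ * ((#E : ℝ) ^ t / (Fintype.card F : ℝ) ^ t.choose 2) := by
  rw [← weightedCount_ite (fun x => x ∈ E) (fun p x y => x.1 + y.1 + lam p = B x.2 y.2)]
  have hS : ∑ x, (if x ∈ E then (1 : ℝ) else 0) = #E := by simp
  have := abs_weightedCount_univ_sub_le (t := t) (f := fun x => if x ∈ E then 1 else 0)
    (K := fun p => sumProductKernel B (lam p)) (δ := δ) (Real.sqrt_nonneg (Fintype.card V))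
    (q := Fintype.card F)
    (by exact_mod_cast Fintype.card_pos) (fun x => by split_ifs <;> norm_num)
    (fun x => by split_ifs <;> norm_num) (by rw [hS]; exact_mod_cast hE.card_pos)
    (fun p x y => by unfold sumProductKernel; split_ifs <;> norm_num)
    (fun p x y => by unfold sumProductKernel; split_ifs <;> norm_num)
    (fun p => hasKernelBound_sumProductKernel B hB (lam p)) hδ (by rw [hS]; exact h)
  rw [hS] at this
  exact this

/-- The form on V × V gives norm √(|V|²) = |V|. Passing from two scalars to their difference has
fibres of size q, whence the extra factor. -/
theorem hasKernelBound_difference (B : LinearMap.BilinForm F V)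
    (hB : ∀ v, (∀ w, B v w = 0) → v = 0) :
    HasKernelBound (fun z z' : (F × V) × (F × V) =>
      sumProductKernel (differenceForm B) 0 (z.1.1 - z.2.1, (z.1.2, z.2.2))
        (z'.1.1 - z'.2.1, (z'.1.2, z'.2.2)) - 1 / (Fintype.card F : ℝ))
      (Fintype.card F * Fintype.card V) := by
  have h := hasKernelBound_sumProductKernel (differenceForm B) (differenceForm_separatingLeft hB) 0
  have hV : √(Fintype.card (V × V) : ℝ) = Fintype.card V := by
    rw [Fintype.card_prod, Nat.cast_mul, Real.sqrt_mul_self (by positivity)]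
  rw [hV] at h
  refine h.comap (by positivity)
    (fun z : (F × V) × (F × V) => (z.1.1 - z.2.1, (z.1.2, z.2.2))) (Fintype.card F) fun y => ?_
  rw [← card_univ]
  refine card_le_card_of_injOn (fun z => z.2.1) (fun _ _ => mem_coe.2 (mem_univ _)) ?_
  rintro ⟨⟨a, v⟩, ⟨a', v'⟩⟩ hz ⟨⟨c, w⟩, ⟨c', w'⟩⟩ hz' hzz
  rw [mem_coe, mem_filter] at hz hz'
  obtain rfl : a' = c' := hzz
  have := hz.2.trans hz'.2.symm
  simp only [Prod.mk.injEq] at this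
  obtain ⟨h1, rfl, rfl⟩ := this
  rw [sub_left_inj] at h1
  rw [h1]

/-- The parameters of the system solved by the tuple `x`. -/
def systemParameter (B : LinearMap.BilinForm F V) (x : Fin t → F × V) (p : IndexPair t) : F :=
  B (x p.1.1).2 (x p.1.2).2 - (x p.1.1).1 - (x p.1.2).1

/-- Subtracting the equations of two tuples with equal parameters eliminates λ. What is left is the
system with parameter 0 for `differenceForm B` on E × E. -/
theorem card_collisions_le (B : LinearMap.BilinForm F V)
    (hB : ∀ v, (∀ w, B v w = 0) → v = 0) (E : Finset (F × V)) (hE : E.Nonempty) {δ : ℝ}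
    (hδ : δ ≤ 1)
    (h : 2 * (t.choose 2 : ℝ) * (Fintype.card F * Fintype.card V * (Fintype.card F : ℝ) ^ (t - 1)) ≤
      δ * (#E : ℝ) ^ 2) :
    (#{z ∈ (Fintype.piFinset fun _ : Fin t => E) ×ˢ (Fintype.piFinset fun _ : Fin t => E) |
        systemParameter B z.1 = systemParameter B z.2} : ℝ) ≤
      (1 + δ) * (((#E : ℝ) ^ t) ^ 2 / (Fintype.card F : ℝ) ^ t.choose 2) := by
  set X := (F × V) × (F × V)
  set r : X → X → Prop := fun z z' => (z.1.1 - z.2.1) + (z'.1.1 - z'.2.1) + 0 =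
    differenceForm B (z.1.2, z.2.2) (z'.1.2, z'.2.2) with hr
  have hS : ∑ z : X, (if z ∈ E ×ˢ E then (1 : ℝ) else 0) = (#E : ℝ) ^ 2 := by
    rw [sum_boole, filter_mem_eq_inter, univ_inter, card_product, sq, Nat.cast_mul]
  have hmain := abs_weightedCount_univ_sub_le (t := t)
    (f := fun z : X => if z ∈ E ×ˢ E then 1 else 0)
    (K := fun _ z z' => if r z z' then 1 else 0) (δ := δ)
    (θ := Fintype.card F * Fintype.card V) (q := Fintype.card F) (by positivity)
    (by exact_mod_cast Fintype.card_pos) (fun x => by split_ifs <;> norm_num)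
    (fun x => by split_ifs <;> norm_num) (by rw [hS]; have := hE.card_pos; positivity)
    (fun p x y => by split_ifs <;> norm_num) (fun p x y => by split_ifs <;> norm_num)
    (fun p => hasKernelBound_difference B hB) hδ (by rw [hS]; exact h)
  rw [hS, weightedCount_ite (fun z => z ∈ E ×ˢ E) (fun _ => r), ← pow_mul, mul_comm 2 t,
    pow_mul] at hmain
  have hcard : #{z ∈ (Fintype.piFinset fun _ : Fin t => E) ×ˢ
      (Fintype.piFinset fun _ : Fin t => E) | systemParameter B z.1 = systemParameter B z.2} =
      #{x : Fin t → X | (∀ k, x k ∈ E ×ˢ E) ∧ ∀ p : IndexPair t, r (x p.1.1) (x p.1.2)} := by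
    refine card_bij (fun z _ k => (z.1 k, z.2 k)) ?_ ?_ ?_
    · intro z hz
      simp only [mem_filter, mem_product, Fintype.mem_piFinset, mem_univ, true_and] at hz ⊢
      refine ⟨fun k => mem_product.2 ⟨hz.1.1 k, hz.1.2 k⟩, fun p => ?_⟩
      have := congrFun hz.2 p
      simp only [systemParameter] at this
      simp only [hr, differenceForm_apply]
      linear_combination -this
    · intro z _ w _ hzw
      refine Prod.ext (funext fun k => ?_) (funext fun k => ?_)
      · exact congrArg Prod.fst (congrFun hzw k)
      · exact congrArg Prod.snd (congrFun hzw k)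
    · intro x hx
      simp only [mem_filter, mem_univ, true_and] at hx
      refine ⟨(fun k => (x k).1, fun k => (x k).2), ?_, rfl⟩
      simp only [mem_filter, mem_product, Fintype.mem_piFinset]
      refine ⟨⟨fun k => (mem_product.1 (hx.1 k)).1, fun k => (mem_product.1 (hx.1 k)).2⟩, funext fun p => ?_⟩
      have := hx.2 p
      simp only [hr, differenceForm_apply] at this
      simp only [systemParameter]
      linear_combination -this
  rw [hcard]
  have := (abs_le.1 hmain).2
  linarith

theorem card_image_systemParameter_ge (B : LinearMap.BilinForm F V)
    (hB : ∀ v, (∀ w, B v w = 0) → v = 0) (E : Finset (F × V)) (hE : E.Nonempty) {δ : ℝ}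
    (hδ0 : 0 ≤ δ) (hδ : δ ≤ 1)
    (h : 2 * (t.choose 2 : ℝ) * (Fintype.card F * Fintype.card V * (Fintype.card F : ℝ) ^ (t - 1)) ≤
      δ * (#E : ℝ) ^ 2) :
    (1 - δ) * (Fintype.card F : ℝ) ^ t.choose 2 ≤
      #((Fintype.piFinset fun _ : Fin t => E).image (systemParameter B)) := by
  set I : ℝ := (#((Fintype.piFinset fun _ : Fin t => E).image (systemParameter B)) : ℝ) with hI
  set Q : ℝ := (Fintype.card F : ℝ) ^ t.choose 2 with hQ
  have hQ0 : 0 < Q := by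
    have : 0 < Fintype.card F := Fintype.card_pos
    positivity
  have h1 : ((#E : ℝ) ^ t) ^ 2 ≤ I * #{z ∈ (Fintype.piFinset fun _ : Fin t => E) ×ˢ
      (Fintype.piFinset fun _ : Fin t => E) | systemParameter B z.1 = systemParameter B z.2} := by
    have := card_sq_le_card_image_mul_card_collisions (Fintype.piFinset fun _ : Fin t => E)
      (systemParameter B)
    rw [Fintype.card_piFinset_const] at this
    rw [hI]
    exact_mod_cast this
  have h2 := h1.trans (mul_le_mul_of_nonneg_left (card_collisions_le B hB E hE hδ h)
    (by rw [hI]; positivity))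
  set W : ℝ := ((#E : ℝ) ^ t) ^ 2 with hW
  have hW0 : 0 < W := by
    have := hE.card_pos
    positivity
  have h3 : Q ≤ I * (1 + δ) := by
    have : W * Q ≤ W * (I * (1 + δ)) := by
      calc W * Q ≤ I * ((1 + δ) * (W / Q)) * Q := by gcongr
        _ = _ := by field_simp
    exact le_of_mul_le_mul_left this hW0
  have h4 : (1 - δ) * Q ≤ (1 - δ) * (I * (1 + δ)) :=
    mul_le_mul_of_nonneg_left h3 (by linarith)
  have h5 : 0 ≤ I := by rw [hI]; positivity
  -- Uses (1 - δ)(1 + δ) = 1 - δ² ≤ 1.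
  nlinarith [mul_nonneg h5 (sq_nonneg δ)]

end Counting
theorem mainTheorem12 (t : ℕ) (ε : ℝ) (hε : 0 < ε) :
    ∃ C : ℝ, 0 < C ∧
      ∀ (F : Type*) [Field F] [Fintype F] (d : ℕ)
        (B : LinearMap.BilinForm F (Fin d → F)) (_ : B.Nondegenerate)
        (E : Finset (F × (Fin d → F))),
        (C * (Fintype.card F : ℝ) ^ ((d : ℝ) / 2 + (t : ℝ) - 1) ≤ (E.card : ℝ) →
          ∀ lam : IndexPair t → F,
            |((sumProductSolutions B E lam).ncard : ℝ)
                - (E.card : ℝ) ^ t / (Fintype.card F : ℝ) ^ (t.choose 2)|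
              ≤ ε * ((E.card : ℝ) ^ t / (Fintype.card F : ℝ) ^ (t.choose 2))) ∧
        (C * (Fintype.card F : ℝ) ^ (((d : ℝ) + (t : ℝ)) / 2) ≤ (E.card : ℝ) →
          (1 - ε) * (Fintype.card F : ℝ) ^ (t.choose 2)
            ≤ ((solvableParameters t B E).ncard : ℝ)) := by
  classical
  set δ : ℝ := min ε 1 with hδ
  have hδ0 : 0 < δ := lt_min hε one_pos
  have hδ1 : δ ≤ 1 := min_le_right _ _
  have hδε : δ ≤ ε := min_le_left _ _
  -- The quotient absorbs an error 2η from each of the `t.choose 2` edges. The summand 1 keeps C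
  -- positive when there are no edges and gives C ≤ C², needed in (2), where |E| enters squared.
  set C : ℝ := 2 * (t.choose 2 : ℝ) / δ + 1 with hC
  have hC1 : 1 ≤ C := by
    have : 0 ≤ 2 * (t.choose 2 : ℝ) / δ := by positivity
    linarith
  have hC0 : 0 < C := by linarith
  have hCδ : 2 * (t.choose 2 : ℝ) ≤ δ * C := by
    rw [hC, mul_add, mul_div_cancel₀ _ hδ0.ne']
    linarith
  refine ⟨C, hC0, fun F _ _ d B hB E => ?_⟩
  set q : ℝ := (Fintype.card F : ℝ) with hq
  have hq0 : 0 < q := by rw [hq]; exact_mod_cast Fintype.card_pos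
  have hV : (Fintype.card (Fin d → F) : ℝ) = q ^ d := by simp [hq]
  have hnonempty : ∀ s : ℝ, C * q ^ s ≤ (#E : ℝ) → E.Nonempty := by
    intro s hs
    have : (0 : ℝ) < #E := lt_of_lt_of_le (by positivity) hs
    exact card_pos.1 (by exact_mod_cast this)
  constructor
  · intro hE lam
    have h : 2 * (t.choose 2 : ℝ) * (√(Fintype.card (Fin d → F)) * q ^ (t - 1)) ≤ δ * #E := by
      -- For t = 0 the natural number t - 1 is 0, unlike the real exponent, but the binomial
      -- coefficient vanishes.
      rcases Nat.eq_zero_or_pos t with rfl | ht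
      · simp only [Nat.choose_zero_succ, Nat.cast_zero, mul_zero, zero_mul]
        positivity
      have hpow : q ^ ((d : ℝ) / 2 + (t : ℝ) - 1) = √(Fintype.card (Fin d → F)) * q ^ (t - 1) := by
        rw [hV, Real.sqrt_eq_rpow, ← Real.rpow_natCast, ← Real.rpow_natCast, ← Real.rpow_mul hq0.le,
          ← Real.rpow_add hq0, Nat.cast_sub ht]
        congr 1
        push_cast
        ring
      rw [← hpow]
      calc _ ≤ δ * C * q ^ ((d : ℝ) / 2 + (t : ℝ) - 1) := by gcongr
        _ ≤ _ := by rw [mul_assoc]; gcongr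
    have hmain := abs_card_solutions_sub_le B hB.1 E (hnonempty _ hE) hδ1 h lam
    have hset : sumProductSolutions B E lam = ({x : Fin t → F × (Fin d → F) | (∀ k, x k ∈ E) ∧
        ∀ p : IndexPair t, (x p.1.1).1 + (x p.1.2).1 + lam p = B (x p.1.1).2 (x p.1.2).2} :
        Finset _) := by
      ext x
      simp [sumProductSolutions]
    rw [hset, Set.ncard_coe_finset]
    exact hmain.trans (mul_le_mul_of_nonneg_right hδε (by positivity))
  · intro hE
    have h : 2 * (t.choose 2 : ℝ) * (q * Fintype.card (Fin d → F) * q ^ (t - 1)) ≤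
        δ * (#E : ℝ) ^ 2 := by
      rcases Nat.eq_zero_or_pos t with rfl | ht
      · simp only [Nat.choose_zero_succ, Nat.cast_zero, mul_zero, zero_mul]
        positivity
      have hpow : (q ^ (((d : ℝ) + (t : ℝ)) / 2)) ^ 2 =
          q * Fintype.card (Fin d → F) * q ^ (t - 1) := by
        obtain ⟨n, rfl⟩ : ∃ n, t = n + 1 := ⟨t - 1, by omega⟩
        rw [hV, ← Real.rpow_natCast, ← Real.rpow_mul hq0.le, Nat.cast_two,
          div_mul_cancel₀ _ two_ne_zero, ← Nat.cast_add, Real.rpow_natCast, Nat.add_sub_cancel]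
        ring
      rw [← hpow]
      calc _ ≤ δ * C * (q ^ (((d : ℝ) + (t : ℝ)) / 2)) ^ 2 := by gcongr
        _ ≤ δ * C ^ 2 * (q ^ (((d : ℝ) + (t : ℝ)) / 2)) ^ 2 := by
            gcongr
            exact le_self_pow₀ hC1 two_ne_zero
        _ = δ * (C * q ^ (((d : ℝ) + (t : ℝ)) / 2)) ^ 2 := by ring
        _ ≤ _ := by gcongr
    have hmain := card_image_systemParameter_ge B hB.1 E (hnonempty _ hE) hδ0.le hδ1 h
    have hset : solvableParameters t B E =
        ((Fintype.piFinset fun _ : Fin t => E).image (systemParameter B) : Finset _) := by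
      ext lam
      simp only [solvableParameters, sumProductSolutions, Set.Nonempty, coe_image, Set.mem_image,
        mem_coe, Fintype.mem_piFinset]
      refine exists_congr fun x => and_congr_right fun _ => ?_
      rw [funext_iff]
      refine forall_congr' fun p => ?_
      simp only [systemParameter]
      constructor <;> intro h <;> linear_combination -h
    rw [hset, Set.ncard_coe_finset]
    refine le_trans ?_ hmain
    gcongr
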